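/- Let $M$ be a bounded, connected, embedded complex submanifold of $\mathbb{C}^d$, with $\partial M := \overline{M}\setminus M$, Kobayashi distance $\mathsf{k}_M$ and Kobayashi--Royden pseudometric $\kappa_M$. For $\lambda \ge 1$ and $\kappa \ge 0$, a $(\lambda,\kappa)$-almost-geodesic is an absolutely continuous curve $\sigma : [a,b] \to M$ such that $\frac{1}{\lambda}|t-s| - \kappa \le \mathsf{k}_M(\sigma(t),\sigma(s)) \le \lambda|t-s| + \kappa$ for all $s,t \in [a,b]$ and $\kappa_M(\sigma(t);\sigma'(t)) \le \lambda$ for almost every $t$; a real Kobayashi geodesic is a map $\sigma:[a,b]\to M$ with $\mathsf{k}_M(\sigma(s),\sigma(t)) = |s-t|$ for all $s,t \in [a,b]$. We say that a class of curves in $M$ is visible if for all $p \ne q$ in $\partial M$ there are neighbourhoods $V$ of $p$ and $W$ of $q$ in $\mathbb{C}^d$ with $\overline{V} \cap \overline{W} = \emptyset$ and a compact set $K \subset M$ such that every curve of the class with initial point in $V$ and terminal point in $W$ meets $K$. For $\kappa>0$, $M$ is a $(1,\kappa)$-visibility submanifold if any two distinct points of $M$ can be joined by a $(1,\kappa)$-almost-geodesic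 and the $(1,\kappa)$-almost-geodesics are visible. $M$ is a BNT-visibility submanifold if $(M,\mathsf{k}_M)$ is Cauchy-complete and the real Kobayashi geodesics are visible. Write $(x|y)_o := \frac12\big(\mathsf{k}_M(x,o) + \mathsf{k}_M(y,o) - \mathsf{k}_M(x,y)\big)$. Let $S \subset \partial M$ be a closed set such that for all $p \ne q$ in $\partial M$ there exist $p' \in \partial M$ and $r > 0$ with $p \in B(p',r)$, $q \in \partial M \setminus \overline{B(p',r)}$ and $S \cap \partial B(p',r) = \emptyset$, where $B(p',r)$ is the Euclidean open ball. Suppose that for some point $o_0 \in M$ and every $\xi\in\partial M \setminus S$, $\mathsf{k}_M(z,o_0) \to \infty$ as $z \to \xi$, $z \in M$. Then, for every $o \in M$, the following are equivalent: 1. For all $p \ne q$ in $\partial M \setminus S$, $\limsup_{(x,y)\to(p,q),\ x,y\in M} (x|y)_o < \infty$. 2. For all $p \ne q$ in $\partial M$, $\limsup_{(x,y)\to(p,q),\ x,y\in M} (x|y)_o < \infty$. 3. $M$ is a $(1,\kappa)$-visibility submanifold for every $\kappa > 0$, and the $(1,0)$-almost-geodesics are visible. Moreover, if (3) holds and $(M,\mathsf{k}_M)$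 is Cauchy-complete, then $M$ is a BNT-visibility submanifold. -/

import Mathlib

open Filter Topology

noncomputable section

namespace KobayashiVisibility

variable {d : ℕ}

/-- Embedded complex submanifolds of `ℂ^d`: there is a dimension `n ≤ d` such that near each point
of `M` some holomorphic change of coordinates of the ambient space flattens `M` to
`ℂ^n × {0}`. -/
def IsEmbeddedComplexSubmanifold (M : Set (EuclideanSpace ℂ (Fin d))) : Prop :=
  ∃ n : ℕ, n ≤ d ∧ ∀ p ∈ M,
    ∃ Φ : OpenPartialHomeomorph (EuclideanSpace ℂ (Fin d)) (EuclideanSpace ℂ (Fin d)),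
      p ∈ Φ.source ∧
      DifferentiableOn ℂ Φ Φ.source ∧
      DifferentiableOn ℂ Φ.symm Φ.target ∧
      ∀ z ∈ Φ.source, z ∈ M ↔ ∀ i : Fin d, n ≤ (i : ℕ) → Φ z i = 0

/-- The boundary `∂M = closure M \ M`. -/
def bdry (M : Set (EuclideanSpace ℂ (Fin d))) : Set (EuclideanSpace ℂ (Fin d)) :=
  closure M \ M

/-- Holomorphic maps from the open unit disc of `ℂ` to `M`. For an embedded submanifold `M` these
are exactly the holomorphic maps into the ambient space with values in `M`. -/
def IsHolomorphicDisc (M : Set (EuclideanSpace ℂ (Fin d)))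
    (f : ℂ → EuclideanSpace ℂ (Fin d)) : Prop :=
  DifferentiableOn ℂ f (Metric.ball 0 1) ∧ Set.MapsTo f (Metric.ball 0 1) M

/-- The Poincaré distance of the unit disc, normalised so that its infinitesimal form is
`|v| / (1 - |ζ|²)`. -/
def poincareDist (a b : ℂ) : ℝ :=
  Real.artanh (‖a - b‖ / ‖1 - (starRingEnd ℂ) a * b‖)

/-- `DiscChain M x y ℓ`: there is a finite chain of holomorphic discs in `M` from `x` to `y` whose
total Poincaré length is `ℓ`. -/
inductive DiscChain (M : Set (EuclideanSpace ℂ (Fin d))) :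
    EuclideanSpace ℂ (Fin d) → EuclideanSpace ℂ (Fin d) → ℝ → Prop
  | nil (x : EuclideanSpace ℂ (Fin d)) (hx : x ∈ M) : DiscChain M x x 0
  | cons (f : ℂ → EuclideanSpace ℂ (Fin d)) (hf : IsHolomorphicDisc M f) (a b : ℂ)
      (ha : a ∈ Metric.ball (0 : ℂ) 1) (hb : b ∈ Metric.ball (0 : ℂ) 1)
      (z : EuclideanSpace ℂ (Fin d)) (l : ℝ) (h : DiscChain M (f b) z l) :
      DiscChain M (f a) z (poincareDist a b + l)

/-- The Kobayashi distance `k_M`: the infimum of the lengths of chains of holomorphic discs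
joining the two points. (When `M` is a connected submanifold such chains exist.) -/
def kobDist (M : Set (EuclideanSpace ℂ (Fin d))) (x y : EuclideanSpace ℂ (Fin d)) : ℝ :=
  sInf {l : ℝ | DiscChain M x y l}

/-- The Kobayashi--Royden pseudometric `κ_M(z; v)`: the infimum of the `α > 0` such that
`α f'(0) = v` for some holomorphic disc `f` in `M` with `f 0 = z`. It is finite when `v` is tangent
to `M` at `z ∈ M`. -/
def kobMetric (M : Set (EuclideanSpace ℂ (Fin d))) (z v : EuclideanSpace ℂ (Fin d)) : ENNReal :=
  sInf {c : ENNReal | ∃ α : ℝ, 0 < α ∧ c = ENNReal.ofReal α ∧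
    ∃ f : ℂ → EuclideanSpace ℂ (Fin d), IsHolomorphicDisc M f ∧ f 0 = z ∧
      (α : ℂ) • deriv f 0 = v}

/-- `σ : [a, b] → M` is a `(lam, kap)`-almost-geodesic. -/
structure IsAlmostGeodesic (M : Set (EuclideanSpace ℂ (Fin d))) (lam kap a b : ℝ)
    (σ : ℝ → EuclideanSpace ℂ (Fin d)) : Prop where
  mapsTo : Set.MapsTo σ (Set.Icc a b) M
  lower : ∀ s ∈ Set.Icc a b, ∀ t ∈ Set.Icc a b,
    (1 / lam) * |t - s| - kap ≤ kobDist M (σ t) (σ s)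
  upper : ∀ s ∈ Set.Icc a b, ∀ t ∈ Set.Icc a b,
    kobDist M (σ t) (σ s) ≤ lam * |t - s| + kap
  absolutelyContinuous : AbsolutelyContinuousOnInterval σ a b
  speed : ∀ᵐ t : ℝ, t ∈ Set.Ioo a b →
    DifferentiableAt ℝ σ t ∧ kobMetric M (σ t) (deriv σ t) ≤ ENNReal.ofReal lam

/-- `σ : [a, b] → M` is a real Kobayashi geodesic: an isometry for `k_M`. -/
structure IsRealGeodesic (M : Set (EuclideanSpace ℂ (Fin d))) (a b : ℝ)
    (σ : ℝ → EuclideanSpace ℂ (Fin d)) : Prop where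
  mapsTo : Set.MapsTo σ (Set.Icc a b) M
  isometry : ∀ s ∈ Set.Icc a b, ∀ t ∈ Set.Icc a b, |s - t| = kobDist M (σ s) (σ t)

/-- Any two distinct points of `M` can be joined by a `(lam, kap)`-almost-geodesic. -/
def JoinedByAlmostGeodesics (M : Set (EuclideanSpace ℂ (Fin d))) (lam kap : ℝ) : Prop :=
  ∀ z ∈ M, ∀ w ∈ M, z ≠ w → ∃ (a b : ℝ) (σ : ℝ → EuclideanSpace ℂ (Fin d)),
    a ≤ b ∧ IsAlmostGeodesic M lam kap a b σ ∧ σ a = z ∧ σ b = w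

/-- The visibility condition for a class `C` of curves `σ : [a, b] → M`: any two distinct boundary
points have neighbourhoods `V`, `W` with disjoint closures and a compact `K ⊆ M` that meets every
curve of the class starting in `V` and ending in `W`. -/
def CurvesVisible (M : Set (EuclideanSpace ℂ (Fin d)))
    (C : ℝ → ℝ → (ℝ → EuclideanSpace ℂ (Fin d)) → Prop) : Prop :=
  ∀ p ∈ bdry M, ∀ q ∈ bdry M, p ≠ q →
    ∃ V ∈ 𝓝 p, ∃ W ∈ 𝓝 q, ∃ K : Set (EuclideanSpace ℂ (Fin d)),
      K ⊆ M ∧ IsCompact K ∧ Disjoint (closure V) (closure W) ∧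
      ∀ (a b : ℝ) (σ : ℝ → EuclideanSpace ℂ (Fin d)), a ≤ b → C a b σ →
        σ a ∈ V → σ b ∈ W → ∃ t ∈ Set.Icc a b, σ t ∈ K

/-- The visibility condition for `(lam, kap)`-almost-geodesics. -/
def AlmostGeodesicsVisible (M : Set (EuclideanSpace ℂ (Fin d))) (lam kap : ℝ) : Prop :=
  CurvesVisible M (IsAlmostGeodesic M lam kap)

/-- `M` is a `(lam, kap)`-visibility submanifold (for `lam ≥ 1`, `kap > 0`). -/
def IsVisibilitySubmanifold (M : Set (EuclideanSpace ℂ (Fin d))) (lam kap : ℝ) : Prop :=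
  JoinedByAlmostGeodesics M lam kap ∧ AlmostGeodesicsVisible M lam kap

/-- `(M, k_M)` is Cauchy-complete. -/
def KobComplete (M : Set (EuclideanSpace ℂ (Fin d))) : Prop :=
  ∀ u : ℕ → EuclideanSpace ℂ (Fin d), (∀ n, u n ∈ M) →
    (∀ ε > 0, ∃ N : ℕ, ∀ m ≥ N, ∀ n ≥ N, kobDist M (u m) (u n) < ε) →
    ∃ x ∈ M, Tendsto (fun n => kobDist M (u n) x) atTop (𝓝 0)

/-- `M` is a BNT-visibility submanifold. -/
def IsBNTVisibilitySubmanifold (M : Set (EuclideanSpace ℂ (Fin d))) : Prop :=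
  KobComplete M ∧ CurvesVisible M (IsRealGeodesic M)

/-- The Gromov product `(x|y)_o` with respect to `k_M`. -/
def gromovProduct (M : Set (EuclideanSpace ℂ (Fin d)))
    (o x y : EuclideanSpace ℂ (Fin d)) : ℝ :=
  (kobDist M x o + kobDist M y o - kobDist M x y) / 2

/-- `limsup (x|y)_o < ∞` as `(x, y) → (p, q)` with `x, y ∈ M`; the limsup is taken in the
extended reals. -/
def GromovProductBoundedAt (M : Set (EuclideanSpace ℂ (Fin d)))
    (o p q : EuclideanSpace ℂ (Fin d)) : Prop :=
  limsup (fun z : EuclideanSpace ℂ (Fin d) × EuclideanSpace ℂ (Fin d) =>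
    ((gromovProduct M o z.1 z.2 : ℝ) : EReal)) (𝓝[M] p ×ˢ 𝓝[M] q) < ⊤

/-- Any two distinct boundary points are separated by a sphere centred at a boundary point and
disjoint from `S`. -/
def SphereSeparated (M S : Set (EuclideanSpace ℂ (Fin d))) : Prop :=
  ∀ p ∈ bdry M, ∀ q ∈ bdry M, p ≠ q → ∃ p' ∈ bdry M, ∃ r : ℝ, 0 < r ∧
    p ∈ Metric.ball p' r ∧ q ∉ Metric.closedBall p' r ∧ S ∩ Metric.sphere p' r = ∅

end KobayashiVisibility

end

open KobayashiVisibility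

/-!
Since spheres missing `S` separate the points of `∂M`, the set `S` is totally separated, so for
`p ≠ q` there is a continuous `φ` on `ℂ^d` with `φ p = 0`, `φ q = 1` and `φ ∉ (0, 1)` on `S`.
A curve from near `p` to near `q` crosses the slab `1/3 ≤ φ ≤ 2/3`, whose closure meets `∂M` only
outside `S`; by compactness the Gromov products of points of the slab lying on levels of `φ` a fixed
distance apart are uniformly bounded.

For a `(1, κ)`-almost-geodesic, the Gromov product of the endpoints exceeds that of two
intermediate points by at most a multiple of `κ`, so boundedness off `S` propagates to all of `∂M`.
Conversely, an almost-geodesic crossing the slab has a point whose distance to the basepoint is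
controlled by these Gromov products; as `k_M(·, o) → ∞` at `∂M \ S`, such points of the slab form
a relatively compact subset of `M`, which gives visibility.

`(1, κ)`-almost-geodesics are obtained by running at unit Poincaré speed through a chain of discs
whose length is within `κ` of `k_M`. Because `M` is bounded, `k_M` dominates a multiple of the
Euclidean distance, so these curves, as well as the real geodesics, are Lipschitz.
-/

namespace KobayashiVisibility

open Set

section Interval

theorem exists_first_hitting {f : ℝ → ℝ} {a b r : ℝ} (hab : a ≤ b)
    (hf : ContinuousOn f (Icc a b)) (ha : f a ≤ r) (hb : r ≤ f b) :
    ∃ t ∈ Icc a b, f t = r ∧ ∀ u ∈ Icc a t, f u ≤ r := by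
  have hcompact : IsCompact (Icc a b ∩ f ⁻¹' {r}) :=
    isCompact_Icc.of_isClosed_subset
      (hf.preimage_isClosed_of_isClosed isClosed_Icc isClosed_singleton) inter_subset_left
  have hne : (Icc a b ∩ f ⁻¹' {r}).Nonempty := by
    obtain ⟨t, ht, hft⟩ := intermediate_value_Icc hab hf ⟨ha, hb⟩
    exact ⟨t, ht, hft⟩
  obtain ⟨t, ⟨ht, hft⟩, hleast⟩ := hcompact.exists_isLeast hne
  refine ⟨t, ht, hft, fun u hu => ?_⟩
  by_contra! hru
  have hub : u ≤ b := hu.2.trans ht.2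
  obtain ⟨v, hv, hfv⟩ :=
    intermediate_value_Icc hu.1 (hf.mono (Icc_subset_Icc_right hub)) ⟨ha, hru.le⟩
  have huv : u ≤ v := hu.2.trans (hleast ⟨⟨hv.1, hv.2.trans hub⟩, hfv⟩)
  rw [le_antisymm hv.2 huv] at hfv
  exact hru.ne' hfv

theorem exists_last_hitting {f : ℝ → ℝ} {a b r : ℝ} (hab : a ≤ b)
    (hf : ContinuousOn f (Icc a b)) (ha : f a ≤ r) (hb : r ≤ f b) :
    ∃ s ∈ Icc a b, f s = r ∧ ∀ u ∈ Icc s b, r ≤ f u := by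
  have hneg : ContinuousOn (fun u => -f (-u)) (Icc (-b) (-a)) :=
    (hf.comp continuousOn_neg fun u hu => ⟨le_neg.2 hu.2, neg_le.2 hu.1⟩).neg
  obtain ⟨t, ht, hft, hle⟩ := exists_first_hitting (r := -r) (neg_le_neg hab) hneg
    (by simpa using hb) (by simpa using ha)
  refine ⟨-t, ⟨le_neg.2 ht.2, neg_le.2 ht.1⟩, neg_injective hft, fun u hu => ?_⟩
  simpa using hle (-u) ⟨neg_le_neg hu.2, neg_le.2 hu.1⟩

theorem exists_crossing {f : ℝ → ℝ} {a b r R : ℝ} (hab : a ≤ b)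
    (hf : ContinuousOn f (Icc a b)) (ha : f a ≤ r) (hrR : r ≤ R) (hb : R ≤ f b) :
    ∃ s t, a ≤ s ∧ s ≤ t ∧ t ≤ b ∧ f s = r ∧ f t = R ∧ MapsTo f (Icc s t) (Icc r R) := by
  obtain ⟨t, ht, hft, hle⟩ := exists_first_hitting hab hf (ha.trans hrR) hb
  obtain ⟨s, hs, hfs, hge⟩ := exists_last_hitting ht.1
    (hf.mono (Icc_subset_Icc_right ht.2)) ha (hrR.trans hft.ge)
  exact ⟨s, t, hs.1, hs.2, ht.2, hfs, hft,
    fun u hu => ⟨hge u hu, hle u ⟨hs.1.trans hu.1, hu.2⟩⟩⟩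

theorem exists_switch {P : ℝ → Prop} {a b ε : ℝ} (hab : a ≤ b) (hε : 0 < ε) (ha : P a)
    (hb : ¬P b) : ∃ u v, a ≤ u ∧ u ≤ v ∧ v ≤ b ∧ v ≤ u + ε ∧ P u ∧ ¬P v := by
  set T : Set ℝ := {u ∈ Icc a b | P u}
  have hbdd : BddAbove T := ⟨b, fun u hu => hu.1.2⟩
  obtain ⟨u, ⟨hu, hPu⟩, hlt⟩ :=
    exists_lt_of_lt_csSup (s := T) ⟨a, ⟨le_rfl, hab⟩, ha⟩ (sub_lt_self _ hε)
  refine ⟨u, min b (u + ε), hu.1, le_min hu.2 (by linarith), min_le_left _ _, min_le_right _ _,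
    hPu, fun hP => ?_⟩
  rcases le_total b (u + ε) with h | h
  · exact hb (min_eq_left h ▸ hP)
  · rw [min_eq_right h] at hP
    linarith [le_csSup hbdd (show u + ε ∈ T from ⟨⟨by linarith [hu.1], h⟩, hP⟩)]

end Interval

section Topology

variable {X : Type*} [TopologicalSpace X]

theorem bddAbove_image_inter_of_isBoundedUnder {f : X → ℝ} {K T : Set X} (hK : IsCompact K)
    (hf : ∀ z ∈ K, IsBoundedUnder (· ≤ ·) (𝓝[T] z) f) : BddAbove (f '' (K ∩ T)) := by
  refine hK.induction_on (p := fun s => BddAbove (f '' (s ∩ T))) (by simp) ?_ ?_ fun z hz => ?_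
  · exact fun s t hst ht => ht.mono (image_mono (inter_subset_inter_left T hst))
  · intro s t hs ht
    rw [union_inter_distrib_right, image_union]
    exact hs.union ht
  · obtain ⟨C, hC⟩ := (hf z hz).eventually_le
    refine ⟨_, nhdsWithin_le_nhds (eventually_nhdsWithin_iff.1 hC), C, ?_⟩
    rintro _ ⟨x, ⟨hx, hxT⟩, rfl⟩
    exact hx hxT

theorem closure_inter_sublevel_subset {f : X → ℝ} {T F : Set X} (hF : IsClosed F)
    (hf : ∀ z ∈ (closure T \ T) ∩ F, Tendsto f (𝓝[T] z) atTop) (R : ℝ) :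
    closure (T ∩ F ∩ {x | f x ≤ R}) ⊆ T := by
  intro z hz
  by_contra hzT
  have hzF : z ∈ F :=
    hF.closure_subset (closure_mono (inter_subset_left.trans inter_subset_right) hz)
  have hzcl : z ∈ closure T :=
    closure_mono (inter_subset_left.trans inter_subset_left) hz
  have hlarge : ∀ᶠ x in 𝓝 z, x ∈ T → R < f x :=
    eventually_nhdsWithin_iff.1 ((hf z ⟨⟨hzcl, hzT⟩, hzF⟩).eventually_gt_atTop R)
  obtain ⟨x, hx, hlt⟩ := ((mem_closure_iff_frequently.1 hz).and_eventually hlarge).exists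
  exact (hlt hx.1.1).not_ge hx.2

theorem exists_isClosed_cover_of_totallySeparated [T1Space X] {S : Set X} (hS : IsClosed S)
    [TotallySeparatedSpace S] {p q : X} (hpq : p ≠ q) :
    ∃ A B, IsClosed A ∧ IsClosed B ∧ Disjoint A B ∧ p ∈ A ∧ q ∈ B ∧ S ⊆ A ∪ B := by
  by_cases hp : p ∈ S
  · by_cases hq : q ∈ S
    · obtain ⟨U, hU, hpU, hqU⟩ := exists_isClopen_of_totally_separated
        (Subtype.coe_ne_coe.1 hpq : (⟨p, hp⟩ : S) ≠ ⟨q, hq⟩)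
      refine ⟨Subtype.val '' U, Subtype.val '' Uᶜ, hU.isClosed.trans hS, hU.compl.isClosed.trans hS,
        disjoint_image_of_injective Subtype.val_injective disjoint_compl_right,
        ⟨_, hpU, rfl⟩, ⟨_, hqU, rfl⟩, ?_⟩
      rw [← image_union, union_compl_self, image_univ, Subtype.range_val]
    · exact ⟨{p} ∪ S, {q}, isClosed_singleton.union hS, isClosed_singleton, by simp [hpq.symm, hq],
        .inl rfl, rfl, subset_union_right.trans subset_union_left⟩
  · exact ⟨{p}, {q} ∪ S, isClosed_singleton, isClosed_singleton.union hS, by simp [hpq, hp],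
      rfl, .inl rfl, subset_union_right.trans subset_union_right⟩

theorem exists_continuousMap_notMem_Ioo [T4Space X] {S : Set X} (hS : IsClosed S)
    [TotallySeparatedSpace S] {p q : X} (hpq : p ≠ q) :
    ∃ φ : C(X, ℝ), φ p = 0 ∧ φ q = 1 ∧ ∀ z ∈ S, φ z ∉ Ioo 0 1 := by
  obtain ⟨A, B, hA, hB, hAB, hp, hq, hcover⟩ := exists_isClosed_cover_of_totallySeparated hS hpq
  obtain ⟨φ, h0, h1, -⟩ := exists_continuous_zero_one_of_isClosed hA hB hAB
  refine ⟨φ, h0 hp, h1 hq, fun z hz hφ => ?_⟩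
  rcases hcover hz with hzA | hzB
  · exact hφ.1.ne' (h0 hzA)
  · exact hφ.2.ne (h1 hzB)

theorem disjoint_closure_preimage_Iio_Ioi {φ : X → ℝ} (hφ : Continuous φ) {r R : ℝ}
    (hrR : r < R) : Disjoint (closure (φ ⁻¹' Iio r)) (closure (φ ⁻¹' Ioi R)) :=
  Disjoint.mono
    (closure_minimal (preimage_mono Iio_subset_Iic_self) (isClosed_Iic.preimage hφ))
    (closure_minimal (preimage_mono Ioi_subset_Ici_self) (isClosed_Ici.preimage hφ))
    ((Iic_disjoint_Ici.2 hrR.not_ge).preimage φ)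

theorem limsup_coe_lt_top_iff_isBoundedUnder {ι : Type*} {l : Filter ι} {f : ι → ℝ} :
    limsup (fun i => (f i : EReal)) l < ⊤ ↔ IsBoundedUnder (· ≤ ·) l f := by
  constructor
  · intro h
    obtain ⟨C, hC, -⟩ := EReal.lt_iff_exists_real_btwn.1 h
    exact isBoundedUnder_of_eventually_le
      ((eventually_lt_of_limsup_lt hC).mono fun i hi => (EReal.coe_lt_coe_iff.1 hi).le)
  · intro h
    obtain ⟨C, hC⟩ := h.eventually_le
    exact (limsup_le_of_le (by isBoundedDefault)
      (hC.mono fun i hi => EReal.coe_le_coe_iff.2 hi)).trans_lt (EReal.coe_lt_top C)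

end Topology
section CoarseGeodesics

variable {E : Type*} {k : E → E → ℝ} {M : Set E} {o x y z u v : E}

/-- `k` restricts to a pseudodistance on `M`. Nothing is asked of its values outside `M`, where the
Kobayashi distance takes junk values. -/
structure IsPseudoDistOn (k : E → E → ℝ) (M : Set E) : Prop where
  self : ∀ ⦃x⦄, x ∈ M → k x x = 0
  symm : ∀ ⦃x⦄, x ∈ M → ∀ ⦃y⦄, y ∈ M → k x y = k y x
  triangle : ∀ ⦃x⦄, x ∈ M → ∀ ⦃y⦄, y ∈ M → ∀ ⦃z⦄, z ∈ M → k x z ≤ k x y + k y z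

/-- The Gromov product `(x|y)_o` of an arbitrary function `k` of two points; `gromovProduct M` is
the case of the Kobayashi distance. -/
noncomputable def gromovProd (k : E → E → ℝ) (o x y : E) : ℝ :=
  (k x o + k y o - k x y) / 2

namespace IsPseudoDistOn

theorem nonneg (hk : IsPseudoDistOn k M) (hx : x ∈ M) (hy : y ∈ M) : 0 ≤ k x y := by
  linarith [hk.triangle hx hy hx, hk.self hx, hk.symm hx hy]

theorem gromovProd_self (hk : IsPseudoDistOn k M) (hx : x ∈ M) : gromovProd k o x x = k x o := by
  rw [gromovProd, hk.self hx]
  ring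

theorem gromovProd_comm (hk : IsPseudoDistOn k M) (hx : x ∈ M) (hy : y ∈ M) :
    gromovProd k o x y = gromovProd k o y x := by
  rw [gromovProd, gromovProd, hk.symm hx hy, add_comm (k x o)]

theorem gromovProd_nonneg (hk : IsPseudoDistOn k M) (ho : o ∈ M) (hx : x ∈ M) (hy : y ∈ M) :
    0 ≤ gromovProd k o x y := by
  rw [gromovProd]
  linarith [hk.triangle hx ho hy, hk.symm hy ho]

theorem gromovProd_le_left (hk : IsPseudoDistOn k M) (ho : o ∈ M) (hx : x ∈ M) (hy : y ∈ M) :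
    gromovProd k o x y ≤ k x o := by
  rw [gromovProd]
  linarith [hk.triangle hy hx ho, hk.symm hx hy]

theorem gromovProd_le_right (hk : IsPseudoDistOn k M) (ho : o ∈ M) (hx : x ∈ M) (hy : y ∈ M) :
    gromovProd k o x y ≤ k y o :=
  hk.gromovProd_comm hx hy ▸ hk.gromovProd_le_left ho hy hx

theorem gromovProd_le_add (hk : IsPseudoDistOn k M) (ho : o ∈ M) (hx : x ∈ M) (hu : u ∈ M)
    (hv : v ∈ M) : gromovProd k o x u ≤ gromovProd k o x v + k u v := by
  rw [gromovProd, gromovProd]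
  linarith [hk.triangle hu hv ho, hk.triangle hx hu hv]

end IsPseudoDistOn

theorem tendsto_atTop_of_basepoint (hk : IsPseudoDistOn k M) {o' : E} (ho : o ∈ M) (ho' : o' ∈ M)
    {l : Filter E} (hl : l ≤ 𝓟 M) (h : Tendsto (k · o') l atTop) : Tendsto (k · o) l atTop := by
  have hle : ∀ᶠ x in l, k x o' + -k o o' ≤ k x o := by
    filter_upwards [le_principal_iff.1 hl] with x hx
    linarith [hk.triangle hx ho ho']
  exact tendsto_atTop_mono' l hle (tendsto_atTop_add_const_right l _ h)

/-- Continuous `(1, κ)`-quasi-geodesics of `(M, k)` on `[a, b]`. This is the common feature of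
almost-geodesics with `λ = 1` and of real geodesics. -/
structure IsCoarseGeodesic [TopologicalSpace E] (k : E → E → ℝ) (M : Set E) (κ a b : ℝ)
    (σ : ℝ → E) : Prop where
  continuousOn : ContinuousOn σ (Icc a b)
  mapsTo : MapsTo σ (Icc a b) M
  abs_sub_le : ∀ ⦃s t⦄, a ≤ s → s ≤ t → t ≤ b → |k (σ s) (σ t) - (t - s)| ≤ κ

variable [TopologicalSpace E] {κ a b : ℝ} {σ : ℝ → E}

namespace IsCoarseGeodesic

theorem mono (hσ : IsCoarseGeodesic k M κ a b σ) {s t : ℝ} (has : a ≤ s) (htb : t ≤ b) :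
    IsCoarseGeodesic k M κ s t σ where
  continuousOn := hσ.continuousOn.mono (Icc_subset_Icc has htb)
  mapsTo := hσ.mapsTo.mono_left (Icc_subset_Icc has htb)
  abs_sub_le _ _ hsu huv hvt := hσ.abs_sub_le (has.trans hsu) huv (hvt.trans htb)

theorem le_add (hσ : IsCoarseGeodesic k M κ a b σ) {s t : ℝ} (has : a ≤ s) (hst : s ≤ t)
    (htb : t ≤ b) : k (σ s) (σ t) ≤ t - s + κ := by
  linarith [(abs_le.1 (hσ.abs_sub_le has hst htb)).2]

theorem sub_le (hσ : IsCoarseGeodesic k M κ a b σ) {s t : ℝ} (has : a ≤ s) (hst : s ≤ t)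
    (htb : t ≤ b) : t - s - κ ≤ k (σ s) (σ t) := by
  linarith [(abs_le.1 (hσ.abs_sub_le has hst htb)).1]

theorem gromovProd_le_subarc (hσ : IsCoarseGeodesic k M κ a b σ) (hk : IsPseudoDistOn k M)
    (ho : o ∈ M) {s t : ℝ} (has : a ≤ s) (hst : s ≤ t) (htb : t ≤ b) :
    gromovProd k o (σ a) (σ b) ≤ gromovProd k o (σ s) (σ t) + 2 * κ := by
  have ha : σ a ∈ M := hσ.mapsTo ⟨le_rfl, has.trans (hst.trans htb)⟩
  have hs : σ s ∈ M := hσ.mapsTo ⟨has, hst.trans htb⟩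
  have ht : σ t ∈ M := hσ.mapsTo ⟨has.trans hst, htb⟩
  have hb : σ b ∈ M := hσ.mapsTo ⟨has.trans (hst.trans htb), le_rfl⟩
  rw [gromovProd, gromovProd]
  linarith [hk.triangle ha hs ho, hk.triangle hb ht ho, hk.symm hb ht,
    hσ.le_add le_rfl has (hst.trans htb), hσ.le_add (has.trans hst) htb le_rfl,
    hσ.sub_le le_rfl (has.trans (hst.trans htb)) le_rfl, hσ.le_add has hst htb]

theorem dist_basepoint_le (hσ : IsCoarseGeodesic k M κ a b σ) {u : ℝ} (hau : a ≤ u)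
    (hub : u ≤ b) :
    k (σ u) o ≤ gromovProd k o (σ a) (σ u) + gromovProd k o (σ u) (σ b)
      - gromovProd k o (σ a) (σ b) + 3 / 2 * κ := by
  simp only [gromovProd]
  linarith [hσ.le_add le_rfl hau hub, hσ.le_add hau hub le_rfl,
    hσ.sub_le le_rfl (hau.trans hub) le_rfl]

/-- Somewhere along the curve the bound passes from `(σ u|σ b)` to `(σ a|σ u)`; there both products
are bounded, and together they control the distance to `o`. -/
theorem exists_dist_basepoint_le (hσ : IsCoarseGeodesic k M κ a b σ) (hk : IsPseudoDistOn k M)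
    (ho : o ∈ M) (hab : a ≤ b) {C : ℝ}
    (hC : ∀ u ∈ Icc a b, gromovProd k o (σ a) (σ u) ≤ C ∨ gromovProd k o (σ u) (σ b) ≤ C) :
    ∃ u ∈ Icc a b, k (σ u) o ≤ 2 * C + 1 + 5 / 2 * κ := by
  have ha : σ a ∈ M := hσ.mapsTo (left_mem_Icc.2 hab)
  have hb : σ b ∈ M := hσ.mapsTo (right_mem_Icc.2 hab)
  have hκ : 0 ≤ κ := (abs_nonneg _).trans (hσ.abs_sub_le le_rfl hab le_rfl)
  by_cases hend : gromovProd k o (σ a) (σ b) ≤ C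
  swap
  · have hbC := (hC b (right_mem_Icc.2 hab)).resolve_left hend
    rw [hk.gromovProd_self hb] at hbC
    exact ⟨b, right_mem_Icc.2 hab, by linarith [hk.nonneg hb ho]⟩
  by_cases haC : gromovProd k o (σ a) (σ a) ≤ C
  · rw [hk.gromovProd_self ha] at haC
    exact ⟨a, left_mem_Icc.2 hab, by linarith [hk.nonneg ha ho]⟩
  obtain ⟨u, v, hau, huv, hvb, hvu, hu, hv⟩ :=
    exists_switch (P := fun u => ¬gromovProd k o (σ a) (σ u) ≤ C) hab one_pos haC (not_not.2 hend)
  have hub : u ≤ b := huv.trans hvb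
  have hright : gromovProd k o (σ u) (σ b) ≤ C := (hC u ⟨hau, hub⟩).resolve_left hu
  have hleft : gromovProd k o (σ a) (σ u) ≤ C + k (σ u) (σ v) :=
    (hk.gromovProd_le_add ho ha (hσ.mapsTo ⟨hau, hub⟩)
      (hσ.mapsTo ⟨hau.trans huv, hvb⟩)).trans (by gcongr; exact not_not.1 hv)
  refine ⟨u, ⟨hau, hub⟩, ?_⟩
  linarith [hσ.dist_basepoint_le (o := o) hau hub, hσ.le_add hau huv hvb,
    hk.gromovProd_nonneg ho ha hb]

theorem exists_crossing (hσ : IsCoarseGeodesic k M κ a b σ) (hab : a ≤ b) {φ : E → ℝ}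
    (hφ : Continuous φ) {r R : ℝ} (ha : φ (σ a) ≤ r) (hrR : r ≤ R) (hb : R ≤ φ (σ b)) :
    ∃ s t, a ≤ s ∧ s ≤ t ∧ t ≤ b ∧ φ (σ s) = r ∧ φ (σ t) = R ∧
      ∀ u ∈ Icc s t, φ (σ u) ∈ Icc r R :=
  KobayashiVisibility.exists_crossing hab (hφ.comp_continuousOn hσ.continuousOn) ha hrR hb

end IsCoarseGeodesic

theorem isBoundedUnder_of_locallyBounded (hk : IsPseudoDistOn k M)
    (hloc : ∀ x ∈ M, IsBoundedUnder (· ≤ ·) (𝓝[M] x) (k x)) (ho : o ∈ M) (hx : x ∈ M) :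
    IsBoundedUnder (· ≤ ·) (𝓝[M] x) (k · o) := by
  obtain ⟨C, hC⟩ := (hloc x hx).eventually_le
  refine isBoundedUnder_of_eventually_le (a := C + k x o) ?_
  filter_upwards [hC, self_mem_nhdsWithin] with z hz hzM
  linarith [hk.triangle hzM hx ho, hk.symm hx hzM]

theorem isBoundedUnder_gromovProd_of_mem (hk : IsPseudoDistOn k M)
    (hloc : ∀ x ∈ M, IsBoundedUnder (· ≤ ·) (𝓝[M] x) (k x)) (ho : o ∈ M) (h : x ∈ M ∨ y ∈ M) :
    IsBoundedUnder (· ≤ ·) (𝓝[M] x ×ˢ 𝓝[M] y) fun w => gromovProd k o w.1 w.2 := by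
  have hmem : ∀ᶠ w in 𝓝[M] x ×ˢ 𝓝[M] y, w.1 ∈ M ∧ w.2 ∈ M :=
    prod_mem_prod self_mem_nhdsWithin self_mem_nhdsWithin
  rcases h with hx | hy
  · exact (tendsto_fst.isBoundedUnder_comp (isBoundedUnder_of_locallyBounded hk hloc ho hx)).mono_le
      (hmem.mono fun w hw => hk.gromovProd_le_left ho hw.1 hw.2)
  · exact (tendsto_snd.isBoundedUnder_comp (isBoundedUnder_of_locallyBounded hk hloc ho hy)).mono_le
      (hmem.mono fun w hw => hk.gromovProd_le_right ho hw.1 hw.2)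

theorem exists_gromovProd_le_of_le_abs_sub (hk : IsPseudoDistOn k M)
    (hloc : ∀ x ∈ M, IsBoundedUnder (· ≤ ·) (𝓝[M] x) (k x)) (ho : o ∈ M) {A : Set E}
    (hA : IsCompact A) {φ : E → ℝ} (hφ : Continuous φ) {δ : ℝ} (hδ : 0 < δ)
    (hbdd : ∀ p ∈ A \ M, ∀ q ∈ A \ M, p ≠ q →
      IsBoundedUnder (· ≤ ·) (𝓝[M] p ×ˢ 𝓝[M] q) fun w => gromovProd k o w.1 w.2) :
    ∃ C, ∀ x ∈ A ∩ M, ∀ y ∈ A ∩ M, δ ≤ |φ x - φ y| → gromovProd k o x y ≤ C := by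
  have hcompact : IsCompact (A ×ˢ A ∩ {w | δ ≤ |φ w.1 - φ w.2|}) :=
    (hA.prod hA).inter_right (isClosed_le continuous_const (by fun_prop))
  obtain ⟨C, hC⟩ := bddAbove_image_inter_of_isBoundedUnder (T := M ×ˢ M)
    (f := fun w => gromovProd k o w.1 w.2) hcompact fun w ⟨hwA, hw⟩ => by
      rw [nhdsWithin_prod_eq]
      by_cases h : w.1 ∈ M ∨ w.2 ∈ M
      · exact isBoundedUnder_gromovProd_of_mem hk hloc ho h
      · rw [not_or] at h
        refine hbdd _ ⟨hwA.1, h.1⟩ _ ⟨hwA.2, h.2⟩ fun heq => ?_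
        rw [mem_ofPred_eq, heq, sub_self, abs_zero] at hw
        exact hδ.not_ge hw
  exact ⟨C, fun x hx y hy hxy =>
    hC ⟨(x, y), ⟨⟨⟨hx.1, hy.1⟩, hxy⟩, hx.2, hy.2⟩, rfl⟩⟩

theorem isBoundedUnder_gromovProd_of_subarc (hk : IsPseudoDistOn k M) (ho : o ∈ M) {p q : E}
    {V W : Set E} (hV : V ∈ 𝓝 p) (hW : W ∈ 𝓝 q) {C : ℝ}
    (h : ∀ x ∈ V ∩ M, ∀ y ∈ W ∩ M, ∃ a b σ, IsCoarseGeodesic k M κ a b σ ∧ σ a = x ∧ σ b = y ∧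
      ∃ s t, a ≤ s ∧ s ≤ t ∧ t ≤ b ∧ gromovProd k o (σ s) (σ t) ≤ C) :
    IsBoundedUnder (· ≤ ·) (𝓝[M] p ×ˢ 𝓝[M] q) fun w => gromovProd k o w.1 w.2 := by
  refine isBoundedUnder_of_eventually_le (a := C + 2 * κ) ?_
  filter_upwards [prod_mem_prod (inter_mem (nhdsWithin_le_nhds hV) self_mem_nhdsWithin)
    (inter_mem (nhdsWithin_le_nhds hW) self_mem_nhdsWithin)]
  rintro ⟨x, y⟩ ⟨hx, hy⟩
  obtain ⟨a, b, σ, hσ, rfl, rfl, s, t, has, hst, htb, hle⟩ := h x hx y hy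
  exact (hσ.gromovProd_le_subarc hk ho has hst htb).trans (by gcongr)

theorem exists_gromovProd_le_of_notMem_Ioo (hk : IsPseudoDistOn k M)
    (hloc : ∀ x ∈ M, IsBoundedUnder (· ≤ ·) (𝓝[M] x) (k x)) (ho : o ∈ M)
    (hM : IsCompact (closure M)) {S : Set E}
    (hbdd : ∀ p ∈ (closure M \ M) \ S, ∀ q ∈ (closure M \ M) \ S, p ≠ q →
      IsBoundedUnder (· ≤ ·) (𝓝[M] p ×ˢ 𝓝[M] q) fun w => gromovProd k o w.1 w.2)
    {φ : E → ℝ} (hφ : Continuous φ) (hφS : ∀ z ∈ S, φ z ∉ Ioo 0 1) {δ : ℝ} (hδ : 0 < δ) :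
    ∃ C, ∀ x ∈ M, ∀ y ∈ M, φ x ∈ Icc (1 / 3) (2 / 3) → φ y ∈ Icc (1 / 3) (2 / 3) →
      δ ≤ |φ x - φ y| → gromovProd k o x y ≤ C := by
  set A : Set E := closure M ∩ φ ⁻¹' Icc (1 / 3) (2 / 3)
  have hA : IsCompact A := hM.inter_right (isClosed_Icc.preimage hφ)
  have hAS : A \ M ⊆ (closure M \ M) \ S := fun z ⟨⟨hzcl, hz⟩, hzM⟩ =>
    ⟨⟨hzcl, hzM⟩, fun hzS => hφS z hzS ⟨by linarith [hz.1], by linarith [hz.2]⟩⟩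
  obtain ⟨C, hC⟩ := exists_gromovProd_le_of_le_abs_sub hk hloc ho hA hφ hδ
    fun p hp q hq => hbdd p (hAS hp) q (hAS hq)
  exact ⟨C, fun x hx y hy hφx hφy =>
    hC x ⟨⟨subset_closure hx, hφx⟩, hx⟩ y ⟨⟨subset_closure hy, hφy⟩, hy⟩⟩

theorem isBoundedUnder_gromovProd_of_totallySeparated [T4Space E] (hk : IsPseudoDistOn k M)
    (hloc : ∀ x ∈ M, IsBoundedUnder (· ≤ ·) (𝓝[M] x) (k x)) (ho : o ∈ M)
    (hM : IsCompact (closure M)) {S : Set E} (hS : IsClosed S) [TotallySeparatedSpace S]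
    (hjoin : ∀ x ∈ M, ∀ y ∈ M, x ≠ y → ∃ a b σ,
      a ≤ b ∧ IsCoarseGeodesic k M κ a b σ ∧ σ a = x ∧ σ b = y)
    (hbdd : ∀ p ∈ (closure M \ M) \ S, ∀ q ∈ (closure M \ M) \ S, p ≠ q →
      IsBoundedUnder (· ≤ ·) (𝓝[M] p ×ˢ 𝓝[M] q) fun w => gromovProd k o w.1 w.2)
    {p q : E} (hpq : p ≠ q) :
    IsBoundedUnder (· ≤ ·) (𝓝[M] p ×ˢ 𝓝[M] q) fun w => gromovProd k o w.1 w.2 := by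
  obtain ⟨φ, hφp, hφq, hφS⟩ := exists_continuousMap_notMem_Ioo hS hpq
  obtain ⟨C, hC⟩ := exists_gromovProd_le_of_notMem_Ioo hk hloc ho hM hbdd φ.continuous hφS
    (δ := 1 / 3) (by norm_num)
  refine isBoundedUnder_gromovProd_of_subarc hk ho (κ := κ) (C := C)
    (φ.continuous.continuousAt (Iio_mem_nhds (by norm_num [hφp] : φ p < 1 / 3)))
    (φ.continuous.continuousAt (Ioi_mem_nhds (by norm_num [hφq] : 2 / 3 < φ q)))
    fun x ⟨hxV, hx⟩ y ⟨hyW, hy⟩ => ?_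
  have hxy : φ x < φ y := lt_trans hxV (lt_trans (by norm_num) hyW)
  obtain ⟨a, b, σ, hab, hσ, rfl, rfl⟩ := hjoin x hx y hy (ne_of_apply_ne φ hxy.ne)
  obtain ⟨s, t, has, hst, htb, hs, ht, -⟩ := hσ.exists_crossing hab φ.continuous (le_of_lt hxV)
    (by norm_num) (le_of_lt hyW)
  refine ⟨a, b, σ, hσ, rfl, rfl, s, t, has, hst, htb, hC _ (hσ.mapsTo ⟨has, hst.trans htb⟩) _
    (hσ.mapsTo ⟨has.trans hst, htb⟩) ?_ ?_ ?_⟩ <;> norm_num [hs, ht]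

theorem exists_isCompact_forall_coarseGeodesic_meets [T4Space E] (hk : IsPseudoDistOn k M)
    (hloc : ∀ x ∈ M, IsBoundedUnder (· ≤ ·) (𝓝[M] x) (k x)) (ho : o ∈ M)
    (hM : IsCompact (closure M)) {S : Set E} (hS : IsClosed S) [TotallySeparatedSpace S]
    (hinf : ∀ p ∈ (closure M \ M) \ S, Tendsto (k · o) (𝓝[M] p) atTop)
    (hbdd : ∀ p ∈ (closure M \ M) \ S, ∀ q ∈ (closure M \ M) \ S, p ≠ q →
      IsBoundedUnder (· ≤ ·) (𝓝[M] p ×ˢ 𝓝[M] q) fun w => gromovProd k o w.1 w.2)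
    (κ : ℝ) {p q : E} (hpq : p ≠ q) :
    ∃ V ∈ 𝓝 p, ∃ W ∈ 𝓝 q, ∃ K ⊆ M, IsCompact K ∧ Disjoint (closure V) (closure W) ∧
      ∀ a b σ, a ≤ b → IsCoarseGeodesic k M κ a b σ → σ a ∈ V → σ b ∈ W →
        ∃ t ∈ Icc a b, σ t ∈ K := by
  obtain ⟨φ, hφp, hφq, hφS⟩ := exists_continuousMap_notMem_Ioo hS hpq
  obtain ⟨C, hC⟩ := exists_gromovProd_le_of_notMem_Ioo hk hloc ho hM hbdd φ.continuous hφS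
    (δ := 1 / 6) (by norm_num)
  set F : Set E := φ ⁻¹' Icc (1 / 3) (2 / 3)
  set K : Set E := closure (M ∩ F ∩ {x | k x o ≤ 2 * C + 1 + 5 / 2 * κ})
  have hKM : K ⊆ M := closure_inter_sublevel_subset (isClosed_Icc.preimage φ.continuous)
    (fun z ⟨hz, hzF⟩ => hinf z ⟨hz, fun hzS =>
      hφS z hzS ⟨by linarith [hzF.1], by linarith [hzF.2]⟩⟩) _
  have hK : IsCompact K := hM.of_isClosed_subset isClosed_closure
    (closure_mono (inter_subset_left.trans inter_subset_left))
  refine ⟨φ ⁻¹' Iio (1 / 3), φ.continuous.continuousAt (Iio_mem_nhds (by norm_num [hφp])),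
    φ ⁻¹' Ioi (2 / 3), φ.continuous.continuousAt (Ioi_mem_nhds (by norm_num [hφq])),
    K, hKM, hK, disjoint_closure_preimage_Iio_Ioi φ.continuous (by norm_num),
    fun a b σ hab hσ ha hb => ?_⟩
  obtain ⟨s, t, has, hst, htb, hs, ht, hmaps⟩ := hσ.exists_crossing hab φ.continuous
    (le_of_lt ha) (by norm_num) (le_of_lt hb)
  have hσst := hσ.mono has htb
  have hfar : ∀ u, 1 / 6 ≤ |φ (σ s) - φ (σ u)| ∨ 1 / 6 ≤ |φ (σ u) - φ (σ t)| := fun u => by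
    rw [hs, ht]
    grind
  obtain ⟨u, hu, hle⟩ := hσst.exists_dist_basepoint_le hk ho hst fun u hu =>
    (hfar u).imp
      (hC _ (hσst.mapsTo (left_mem_Icc.2 hst)) _ (hσst.mapsTo hu)
        (hmaps s (left_mem_Icc.2 hst)) (hmaps u hu))
      (hC _ (hσst.mapsTo hu) _ (hσst.mapsTo (right_mem_Icc.2 hst))
        (hmaps u hu) (hmaps t (right_mem_Icc.2 hst)))
  exact ⟨u, Icc_subset_Icc has htb hu, subset_closure ⟨⟨hσst.mapsTo hu, hmaps u hu⟩, hle⟩⟩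

end CoarseGeodesics
section UnitDisc

/-- The automorphism `ζ ↦ (ζ + a) / (1 + ā ζ)` of the unit disc, which moves `0` to `a`. -/
noncomputable def discAut (a ζ : ℂ) : ℂ := (ζ + a) / (1 + (starRingEnd ℂ) a * ζ)

variable {a b ζ : ℂ}

theorem one_add_conj_mul_ne_zero (ha : ‖a‖ < 1) (hζ : ‖ζ‖ < 1) :
    1 + (starRingEnd ℂ) a * ζ ≠ 0 := by
  intro h
  have hnorm : ‖a‖ * ‖ζ‖ = 1 := by
    rw [← RCLike.norm_conj a, ← norm_mul, eq_neg_of_add_eq_zero_right h, norm_neg, norm_one]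
  exact (mul_lt_one_of_nonneg_of_lt_one_left (norm_nonneg a) ha hζ.le).ne hnorm

theorem sq_norm_one_add_conj_mul_sub (a ζ : ℂ) :
    ‖1 + (starRingEnd ℂ) a * ζ‖ ^ 2 - ‖ζ + a‖ ^ 2 = (1 - ‖a‖ ^ 2) * (1 - ‖ζ‖ ^ 2) := by
  simp only [← Complex.normSq_eq_norm_sq, Complex.normSq_apply, Complex.add_re, Complex.add_im,
    Complex.mul_re, Complex.mul_im, Complex.one_re, Complex.one_im, Complex.conj_re,
    Complex.conj_im]
  ring

theorem norm_discAut_lt_one (ha : ‖a‖ < 1) (hζ : ‖ζ‖ < 1) : ‖discAut a ζ‖ < 1 := by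
  have hden := norm_pos_iff.2 (one_add_conj_mul_ne_zero ha hζ)
  have hgap : 0 < (1 - ‖a‖ ^ 2) * (1 - ‖ζ‖ ^ 2) :=
    mul_pos (by nlinarith [norm_nonneg a]) (by nlinarith [norm_nonneg ζ])
  rw [discAut, norm_div, div_lt_one hden]
  exact lt_of_pow_lt_pow_left₀ 2 hden.le (by linarith [sq_norm_one_add_conj_mul_sub a ζ])

theorem hasDerivAt_discAut (ha : ‖a‖ < 1) (hζ : ‖ζ‖ < 1) :
    HasDerivAt (discAut a)
      ((1 - a * (starRingEnd ℂ) a) / (1 + (starRingEnd ℂ) a * ζ) ^ 2) ζ := by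
  have hnum : HasDerivAt (fun ζ : ℂ => ζ + a) 1 ζ := (hasDerivAt_id ζ).add_const a
  have hden : HasDerivAt (fun ζ : ℂ => 1 + (starRingEnd ℂ) a * ζ) ((starRingEnd ℂ) a) ζ := by
    simpa using ((hasDerivAt_id ζ).const_mul ((starRingEnd ℂ) a)).const_add 1
  convert! hnum.div hden (one_add_conj_mul_ne_zero ha hζ) using 1
  ring

theorem discAut_zero (a : ℂ) : discAut a 0 = a := by simp [discAut]

theorem discAut_discAut_neg (ha : ‖a‖ < 1) (hb : ‖b‖ < 1) : discAut a (discAut (-a) b) = b := by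
  have ha' : ‖-a‖ < 1 := by rwa [norm_neg]
  have hin := one_add_conj_mul_ne_zero ha' hb
  have hmul : discAut (-a) b * (1 + (starRingEnd ℂ) (-a) * b) = b + -a := div_mul_cancel₀ _ hin
  rw [discAut, div_eq_iff (one_add_conj_mul_ne_zero ha (norm_discAut_lt_one ha' hb))]
  apply mul_right_cancel₀ hin
  rw [map_neg] at hmul ⊢
  linear_combination (1 - b * (starRingEnd ℂ) a) * hmul

theorem poincareDist_eq_artanh_norm_discAut (a b : ℂ) :
    poincareDist a b = Real.artanh ‖discAut (-a) b‖ := by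
  rw [poincareDist, discAut, norm_div, map_neg, neg_mul, ← sub_eq_add_neg, ← sub_eq_add_neg,
    norm_sub_rev a b]

theorem poincareDist_nonneg (a b : ℂ) : 0 ≤ poincareDist a b :=
  Real.artanh_nonneg (by positivity)

theorem poincareDist_comm (a b : ℂ) : poincareDist a b = poincareDist b a := by
  rw [poincareDist, poincareDist, norm_sub_rev a b, ← RCLike.norm_conj (1 - _)]
  simp only [map_sub, map_one, map_mul, Complex.conj_conj, mul_comm]

theorem tanh_poincareDist (ha : ‖a‖ < 1) (hb : ‖b‖ < 1) :
    Real.tanh (poincareDist a b) = ‖discAut (-a) b‖ := by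
  rw [poincareDist_eq_artanh_norm_discAut, Real.tanh_artanh]
  exact ⟨neg_one_lt_zero.trans_le (norm_nonneg _), norm_discAut_lt_one (by rwa [norm_neg]) hb⟩

theorem norm_ofReal_tanh_lt_one (x : ℝ) : ‖(Real.tanh x : ℂ)‖ < 1 := by
  rw [Complex.norm_real]
  exact Real.abs_tanh_lt_one x

theorem hasDerivAt_tanh (x : ℝ) : HasDerivAt Real.tanh (1 - Real.tanh x ^ 2) x := by
  have hcosh := (Real.cosh_pos x).ne'
  rw [show Real.tanh = Real.sinh / Real.cosh from funext Real.tanh_eq_sinh_div_cosh]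
  convert! (Real.hasDerivAt_sinh x).div (Real.hasDerivAt_cosh x) hcosh using 1
  simp only [Pi.div_apply]
  field_simp

theorem tanh_nonneg {x : ℝ} (hx : 0 ≤ x) : 0 ≤ Real.tanh x := by
  rw [Real.tanh_eq_sinh_div_cosh]
  exact div_nonneg (Real.sinh_nonneg_iff.2 hx) (Real.cosh_pos x).le

theorem tanh_le_self {x : ℝ} (hx : 0 ≤ x) : Real.tanh x ≤ x := by
  have hderiv : ∀ y, HasDerivAt (fun y => y - Real.tanh y) (Real.tanh y ^ 2) y := fun y => by
    simpa using (hasDerivAt_id' y).fun_sub (hasDerivAt_tanh y)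
  have hmono : Monotone fun y => y - Real.tanh y :=
    monotone_of_hasDerivAt_nonneg hderiv fun y => sq_nonneg _
  simpa using hmono hx

theorem tanh_sub (s t : ℝ) :
    Real.tanh (t - s) = (Real.tanh t - Real.tanh s) / (1 - Real.tanh s * Real.tanh t) := by
  have hs := (Real.cosh_pos s).ne'
  have ht := (Real.cosh_pos t).ne'
  simp only [Real.tanh_eq_sinh_div_cosh, Real.sinh_sub, Real.cosh_sub]
  field_simp

theorem poincareDist_tanh {s t : ℝ} (hst : s ≤ t) :
    poincareDist (Real.tanh s : ℂ) (Real.tanh t : ℂ) = t - s := by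
  have haut : discAut (-(Real.tanh s : ℂ)) (Real.tanh t) = (Real.tanh (t - s) : ℂ) := by
    rw [tanh_sub, discAut, map_neg, Complex.conj_ofReal]
    push_cast
    ring
  rw [poincareDist_eq_artanh_norm_discAut, haut, Complex.norm_real,
    Real.norm_of_nonneg (tanh_nonneg (sub_nonneg.2 hst)), Real.artanh_tanh]

end UnitDisc

section KobayashiDistance

variable {M : Set (EuclideanSpace ℂ (Fin d))} {x y z : EuclideanSpace ℂ (Fin d)}
  {f : ℂ → EuclideanSpace ℂ (Fin d)} {a b : ℂ} {l m : ℝ}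

theorem IsHolomorphicDisc.comp {g : ℂ → ℂ} (hf : IsHolomorphicDisc M f)
    (hg : DifferentiableOn ℂ g (Metric.ball 0 1))
    (hmaps : MapsTo g (Metric.ball 0 1) (Metric.ball 0 1)) : IsHolomorphicDisc M (f ∘ g) :=
  ⟨hf.1.comp hg hmaps, hf.2.comp hmaps⟩

theorem IsHolomorphicDisc.comp_discAut (hf : IsHolomorphicDisc M f) (ha : ‖a‖ < 1) :
    IsHolomorphicDisc M (f ∘ discAut a) := by
  refine hf.comp (fun ζ hζ => ?_) (fun ζ hζ => ?_) <;> rw [mem_ball_zero_iff] at *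
  · exact (hasDerivAt_discAut ha hζ).differentiableAt.differentiableWithinAt
  · exact norm_discAut_lt_one ha hζ

theorem IsHolomorphicDisc.exists_normalization (hf : IsHolomorphicDisc M f) (ha : ‖a‖ < 1)
    (hb : ‖b‖ < 1) :
    ∃ g, IsHolomorphicDisc M g ∧ g 0 = f a ∧ g (Real.tanh (poincareDist a b) : ℂ) = f b := by
  obtain ⟨e, he, hmul⟩ : ∃ e : ℂ, ‖e‖ = 1 ∧ (‖discAut (-a) b‖ : ℂ) * e = discAut (-a) b :=
    ⟨_, Complex.norm_exp_ofReal_mul_I _, Complex.norm_mul_exp_arg_mul_I _⟩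
  have hrot : MapsTo (fun ζ : ℂ => ζ * e) (Metric.ball 0 1) (Metric.ball 0 1) := fun ζ hζ => by
    simpa [he] using hζ
  refine ⟨_, (hf.comp_discAut ha).comp (by fun_prop) hrot, ?_, ?_⟩
  · simp only [Function.comp_apply, zero_mul, discAut_zero]
  · simp only [Function.comp_apply, tanh_poincareDist ha hb, hmul, discAut_discAut_neg ha hb]

theorem DiscChain.nonneg (h : DiscChain M x y l) : 0 ≤ l := by
  induction h with
  | nil => exact le_rfl
  | cons _ _ a b _ _ _ _ _ ih => exact add_nonneg (poincareDist_nonneg a b) ih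

theorem DiscChain.trans (hxy : DiscChain M x y l) (hyz : DiscChain M y z m) :
    DiscChain M x z (l + m) := by
  induction hxy with
  | nil => rwa [zero_add]
  | cons f hf a b ha hb w l _ ih =>
    rw [add_assoc]
    exact .cons f hf a b ha hb z _ (ih hyz)

theorem DiscChain.single (hf : IsHolomorphicDisc M f) (ha : a ∈ Metric.ball 0 1)
    (hb : b ∈ Metric.ball 0 1) : DiscChain M (f a) (f b) (poincareDist a b) := by
  simpa only [add_zero] using DiscChain.cons f hf a b ha hb (f b) 0 (.nil _ (hf.2 hb))

theorem DiscChain.symm (h : DiscChain M x y l) : DiscChain M y x l := by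
  induction h with
  | nil x hx => exact .nil x hx
  | cons f hf a b ha hb z l h ih =>
    rw [add_comm, poincareDist_comm]
    exact ih.trans (.single hf hb ha)

theorem kobDist_le (h : DiscChain M x y l) : kobDist M x y ≤ l :=
  csInf_le ⟨0, fun _ h => DiscChain.nonneg h⟩ h

theorem kobDist_nonneg (M : Set (EuclideanSpace ℂ (Fin d))) (x y : EuclideanSpace ℂ (Fin d)) :
    0 ≤ kobDist M x y :=
  Real.sInf_nonneg fun _ h => DiscChain.nonneg h

theorem kobDist_self (hx : x ∈ M) : kobDist M x x = 0 :=
  (kobDist_le (.nil x hx)).antisymm (kobDist_nonneg M x x)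

theorem kobDist_comm (M : Set (EuclideanSpace ℂ (Fin d))) (x y : EuclideanSpace ℂ (Fin d)) :
    kobDist M x y = kobDist M y x :=
  congrArg sInf (ext fun _ => ⟨DiscChain.symm, DiscChain.symm⟩)

theorem IsEmbeddedComplexSubmanifold.eventually_discChain (hM : IsEmbeddedComplexSubmanifold M)
    (hx : x ∈ M) : ∀ᶠ y in 𝓝[M] x, DiscChain M x y (Real.artanh (1 / 2)) := by
  obtain ⟨n, -, hM⟩ := hM
  obtain ⟨Φ, hxs, -, hsymm, hflat⟩ := hM x hx
  obtain ⟨r, hr, hball⟩ := Metric.isOpen_iff.1 Φ.open_target (Φ x) (Φ.map_source hxs)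
  have hnear : ∀ᶠ y in 𝓝[M] x, Φ y ∈ Metric.ball (Φ x) (r / 2) :=
    nhdsWithin_le_nhds ((Φ.continuousAt hxs).eventually (Metric.ball_mem_nhds _ (half_pos hr)))
  filter_upwards [hnear, self_mem_nhdsWithin,
    nhdsWithin_le_nhds (Φ.open_source.mem_nhds hxs)] with y hy hyM hys
  -- The complex line through `Φ x` and `Φ y`, parametrised so that `1 / 2 ↦ Φ y`.
  let g : ℂ → EuclideanSpace ℂ (Fin d) := fun ζ => Φ x + (2 * ζ) • (Φ y - Φ x)
  have hg_maps : MapsTo g (Metric.ball 0 1) Φ.target := by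
    intro ζ hζ
    apply hball
    rw [mem_ball_zero_iff] at hζ
    rw [mem_ball_iff_norm] at hy ⊢
    simp only [g, add_sub_cancel_left, norm_smul, norm_mul, Complex.norm_ofNat]
    nlinarith [norm_nonneg ζ, norm_nonneg (Φ y - Φ x)]
  have hdisc : IsHolomorphicDisc M (Φ.symm ∘ g) := by
    refine ⟨hsymm.comp (by fun_prop) hg_maps, fun ζ hζ => ?_⟩
    refine (hflat _ (Φ.map_target (hg_maps hζ))).2 fun i hi => ?_
    have hxi := (hflat x hxs).1 hx i hi
    have hyi := (hflat y hys).1 hyM i hi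
    simp [Φ.right_inv (hg_maps hζ), g, hxi, hyi]
  have hchain := DiscChain.single hdisc (a := 0) (b := 1 / 2) (by simp) (by norm_num)
  simpa [g, Φ.left_inv hxs, Φ.left_inv hys, poincareDist] using hchain

theorem exists_discChain (hM : IsEmbeddedComplexSubmanifold M) (hconn : IsPreconnected M)
    (hx : x ∈ M) (hy : y ∈ M) : ∃ l, DiscChain M x y l :=
  hconn.induction₂ (fun x y => ∃ l, DiscChain M x y l)
    (fun _ hx => (hM.eventually_discChain hx).mono fun _ h => ⟨_, h⟩)
    (fun _ _ _ _ _ _ ⟨l, h⟩ ⟨m, h'⟩ => ⟨l + m, h.trans h'⟩)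
    (fun _ _ _ _ ⟨l, h⟩ => ⟨l, h.symm⟩) hx hy

theorem exists_discChain_lt (hM : IsEmbeddedComplexSubmanifold M) (hconn : IsPreconnected M)
    (hx : x ∈ M) (hy : y ∈ M) {r : ℝ} (hr : kobDist M x y < r) :
    ∃ l < r, DiscChain M x y l := by
  obtain ⟨l, hl, hlr⟩ := exists_lt_of_csInf_lt (exists_discChain hM hconn hx hy) hr
  exact ⟨l, hlr, hl⟩

theorem isPseudoDistOn_kobDist (hM : IsEmbeddedComplexSubmanifold M) (hconn : IsPreconnected M) :
    IsPseudoDistOn (kobDist M) M where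
  self _ := kobDist_self
  symm x _ y _ := kobDist_comm M x y
  triangle x hx y hy z hz := by
    refine le_of_forall_pos_lt_add fun ε hε => ?_
    obtain ⟨l, hl, hxy⟩ := exists_discChain_lt hM hconn hx hy
      (lt_add_of_pos_right (kobDist M x y) (half_pos hε))
    obtain ⟨m, hm, hyz⟩ := exists_discChain_lt hM hconn hy hz
      (lt_add_of_pos_right (kobDist M y z) (half_pos hε))
    linarith [kobDist_le (hxy.trans hyz)]

theorem IsEmbeddedComplexSubmanifold.isBoundedUnder_kobDist (hM : IsEmbeddedComplexSubmanifold M)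
    (hx : x ∈ M) : IsBoundedUnder (· ≤ ·) (𝓝[M] x) (kobDist M x) :=
  ⟨_, eventually_map.2 ((hM.eventually_discChain hx).mono fun _ => kobDist_le)⟩

theorem DiscChain.dist_le (hbdd : Bornology.IsBounded M) (h : DiscChain M x y l) :
    dist x y ≤ Metric.diam M * l := by
  induction h with
  | nil => simp
  | cons f hf a b ha hb z l h ih =>
    rw [mem_ball_zero_iff] at ha hb
    obtain ⟨g, hg, hga, hgb⟩ := hf.exists_normalization ha hb
    have hδ := poincareDist_nonneg a b
    have hschwarz := Complex.dist_le_div_mul_dist_of_mapsTo_ball hg.1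
      (fun ζ hζ => Metric.mem_closedBall.2
        (Metric.dist_le_diam_of_mem hbdd (hg.2 hζ) (hg.2 (Metric.mem_ball_self one_pos))))
      (mem_ball_zero_iff.2 (norm_ofReal_tanh_lt_one (poincareDist a b)))
    rw [hga, hgb, dist_zero_right, Complex.norm_real, Real.norm_of_nonneg (tanh_nonneg hδ),
      div_one, dist_comm] at hschwarz
    calc dist (f a) z ≤ dist (f a) (f b) + dist (f b) z := dist_triangle _ _ _
      _ ≤ Metric.diam M * Real.tanh (poincareDist a b) + Metric.diam M * l :=
        add_le_add hschwarz ih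
      _ ≤ Metric.diam M * (poincareDist a b + l) := by
        rw [← mul_add]
        gcongr
        exact tanh_le_self hδ

open scoped Pointwise in
theorem dist_le_diam_mul_kobDist (hM : IsEmbeddedComplexSubmanifold M) (hconn : IsPreconnected M)
    (hbdd : Bornology.IsBounded M) (hx : x ∈ M) (hy : y ∈ M) :
    dist x y ≤ Metric.diam M * kobDist M x y := by
  rw [kobDist, ← smul_eq_mul, ← Real.sInf_smul_of_nonneg Metric.diam_nonneg]
  refine le_csInf (Nonempty.smul_set (exists_discChain hM hconn hx hy)) ?_
  rintro _ ⟨l, hl, rfl⟩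
  exact DiscChain.dist_le hbdd hl

theorem lipschitzOnWith_of_kobDist_le (hM : IsEmbeddedComplexSubmanifold M)
    (hconn : IsPreconnected M) (hbdd : Bornology.IsBounded M) {I : Set ℝ}
    {σ : ℝ → EuclideanSpace ℂ (Fin d)} (hmaps : MapsTo σ I M)
    (hσ : ∀ s ∈ I, ∀ t ∈ I, kobDist M (σ s) (σ t) ≤ |s - t|) :
    LipschitzOnWith (Metric.diam M).toNNReal σ I := by
  refine LipschitzOnWith.of_dist_le_mul fun s hs t ht => ?_
  rw [Real.coe_toNNReal _ Metric.diam_nonneg, Real.dist_eq]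
  exact (dist_le_diam_mul_kobDist hM hconn hbdd (hmaps hs) (hmaps ht)).trans
    (mul_le_mul_of_nonneg_left (hσ s hs t ht) Metric.diam_nonneg)

end KobayashiDistance

section Curves

variable {M : Set (EuclideanSpace ℂ (Fin d))} {x y : EuclideanSpace ℂ (Fin d)}

/-- Curves on `[0, L]` that do not expand distances from the parameter interval to `k_M` and have
infinitesimal speed at most `1`: the curves traced along chains of holomorphic discs. -/
structure IsNonexpandingCurve (M : Set (EuclideanSpace ℂ (Fin d))) (L : ℝ)
    (σ : ℝ → EuclideanSpace ℂ (Fin d)) : Prop where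
  mapsTo : MapsTo σ (Icc 0 L) M
  kobDist_le : ∀ s ∈ Icc 0 L, ∀ t ∈ Icc 0 L, s ≤ t → kobDist M (σ s) (σ t) ≤ t - s
  speed : ∀ᵐ t : ℝ, t ∈ Ioo 0 L → ∃ v, HasDerivAt σ v t ∧ kobMetric M (σ t) v ≤ 1

theorem IsHolomorphicDisc.kobMetric_le_one {f : ℂ → EuclideanSpace ℂ (Fin d)}
    (hf : IsHolomorphicDisc M f) {a : ℂ} (ha : ‖a‖ < 1) :
    kobMetric M (f a) ((1 - a * (starRingEnd ℂ) a) • deriv f a) ≤ 1 := by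
  have hfa : HasDerivAt f (deriv f a) (discAut a 0) := by
    rw [discAut_zero]
    exact (hf.1.differentiableAt
      (Metric.isOpen_ball.mem_nhds (mem_ball_zero_iff.2 ha))).hasDerivAt
  have haut := hasDerivAt_discAut ha (ζ := 0) (by simp)
  rw [mul_zero, add_zero, one_pow, div_one] at haut
  refine sInf_le ⟨1, one_pos, ENNReal.ofReal_one.symm, f ∘ discAut a, hf.comp_discAut ha, ?_, ?_⟩
  · rw [Function.comp_apply, discAut_zero]
  · rw [(HasDerivAt.scomp 0 hfa haut).deriv, Complex.ofReal_one, one_smul]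

theorem IsHolomorphicDisc.isNonexpandingCurve {g : ℂ → EuclideanSpace ℂ (Fin d)}
    (hg : IsHolomorphicDisc M g) (L : ℝ) :
    IsNonexpandingCurve M L fun t => g (Real.tanh t : ℂ) := by
  have hmem : ∀ t, (Real.tanh t : ℂ) ∈ Metric.ball 0 1 := fun t =>
    mem_ball_zero_iff.2 (norm_ofReal_tanh_lt_one t)
  refine ⟨fun t _ => hg.2 (hmem t), fun s _ t _ hst => ?_, .of_forall fun t _ => ?_⟩
  · exact (KobayashiVisibility.kobDist_le (.single hg (hmem s) (hmem t))).trans_eq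
      (poincareDist_tanh hst)
  · have hderiv := (hg.1.differentiableAt (Metric.isOpen_ball.mem_nhds (hmem t))).hasDerivAt
    refine ⟨_, HasDerivAt.scomp t hderiv (hasDerivAt_tanh t).ofReal_comp, ?_⟩
    convert! hg.kobMetric_le_one (norm_ofReal_tanh_lt_one t) using 3
    rw [Complex.conj_ofReal]
    push_cast
    ring

namespace IsNonexpandingCurve

variable {L L₁ L₂ : ℝ} {σ σ₁ σ₂ : ℝ → EuclideanSpace ℂ (Fin d)}

theorem kobDist_le_abs_sub (hσ : IsNonexpandingCurve M L σ) {s t : ℝ} (hs : s ∈ Icc 0 L)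
    (ht : t ∈ Icc 0 L) : kobDist M (σ s) (σ t) ≤ |s - t| := by
  rcases le_total s t with hst | hts
  · rw [abs_sub_comm, abs_of_nonneg (sub_nonneg.2 hst)]
    exact hσ.kobDist_le s hs t ht hst
  · rw [kobDist_comm, abs_of_nonneg (sub_nonneg.2 hts)]
    exact hσ.kobDist_le t ht s hs hts

theorem kobDist_concat_le (hk : IsPseudoDistOn (kobDist M) M) (h₁ : IsNonexpandingCurve M L₁ σ₁)
    (h₂ : IsNonexpandingCurve M L₂ σ₂) (hglue : σ₁ L₁ = σ₂ 0) {s t : ℝ}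
    (hs : s ∈ Icc 0 L₁) (ht : t ∈ Icc 0 L₂) : kobDist M (σ₁ s) (σ₂ t) ≤ L₁ + t - s := by
  have hL₁ : L₁ ∈ Icc 0 L₁ := right_mem_Icc.2 (hs.1.trans hs.2)
  have hL₂ : (0 : ℝ) ∈ Icc 0 L₂ := left_mem_Icc.2 (ht.1.trans ht.2)
  calc kobDist M (σ₁ s) (σ₂ t)
      ≤ kobDist M (σ₁ s) (σ₁ L₁) + kobDist M (σ₁ L₁) (σ₂ t) :=
        hk.triangle (h₁.mapsTo hs) (h₁.mapsTo hL₁) (h₂.mapsTo ht)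
    _ ≤ (L₁ - s) + (t - 0) :=
        add_le_add (h₁.kobDist_le s hs L₁ hL₁ hs.2) (hglue ▸ h₂.kobDist_le 0 hL₂ t ht ht.1)
    _ = L₁ + t - s := by ring

theorem ae_speed_concat (h₁ : IsNonexpandingCurve M L₁ σ₁) (h₂ : IsNonexpandingCurve M L₂ σ₂) :
    let σ := fun t => if t ≤ L₁ then σ₁ t else σ₂ (t - L₁)
    ∀ᵐ t : ℝ, t ∈ Ioo 0 (L₁ + L₂) → ∃ v, HasDerivAt σ v t ∧ kobMetric M (σ t) v ≤ 1 := by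
  have hshift := (MeasureTheory.measurePreserving_sub_right
    MeasureTheory.volume L₁).quasiMeasurePreserving.ae h₂.speed
  filter_upwards [h₁.speed, hshift, MeasureTheory.Measure.ae_ne MeasureTheory.volume L₁]
    with t ht₁ ht₂ hne ht
  rcases lt_or_gt_of_ne hne with hlt | hgt
  · obtain ⟨v, hv, hle⟩ := ht₁ ⟨ht.1, hlt⟩
    refine ⟨v, hv.congr_of_eventuallyEq ?_, by rwa [if_pos hlt.le]⟩
    filter_upwards [Iio_mem_nhds hlt] with u hu using if_pos (le_of_lt hu)
  · obtain ⟨v, hv, hle⟩ := ht₂ ⟨by linarith, by linarith [ht.2]⟩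
    refine ⟨v, (hv.comp_sub_const t L₁).congr_of_eventuallyEq ?_, by rwa [if_neg hgt.not_ge]⟩
    filter_upwards [Ioi_mem_nhds hgt] with u hu using if_neg (not_le_of_gt hu)

theorem concat (hk : IsPseudoDistOn (kobDist M) M) (h₁ : IsNonexpandingCurve M L₁ σ₁)
    (h₂ : IsNonexpandingCurve M L₂ σ₂) (hglue : σ₁ L₁ = σ₂ 0) :
    IsNonexpandingCurve M (L₁ + L₂) fun t => if t ≤ L₁ then σ₁ t else σ₂ (t - L₁) := by
  have hmem : ∀ {t}, t ∈ Icc 0 (L₁ + L₂) → L₁ < t → t - L₁ ∈ Icc 0 L₂ := fun ht hgt =>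
    ⟨by linarith, by linarith [ht.2]⟩
  refine ⟨fun t ht => ?_, fun s hs t ht hst => ?_, h₁.ae_speed_concat h₂⟩
  · rcases le_or_gt t L₁ with htL | htL
    · simpa only [if_pos htL] using h₁.mapsTo ⟨ht.1, htL⟩
    · simpa only [if_neg htL.not_ge] using h₂.mapsTo (hmem ht htL)
  · rcases le_or_gt t L₁ with htL | htL
    · have hsL := hst.trans htL
      simpa only [if_pos htL, if_pos hsL] using h₁.kobDist_le s ⟨hs.1, hsL⟩ t ⟨ht.1, htL⟩ hst
    · rcases le_or_gt s L₁ with hsL | hsL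
      · simp only [if_neg htL.not_ge, if_pos hsL]
        linarith [h₁.kobDist_concat_le hk h₂ hglue ⟨hs.1, hsL⟩ (hmem ht htL)]
      · simp only [if_neg htL.not_ge, if_neg hsL.not_ge]
        linarith [h₂.kobDist_le _ (hmem hs hsL) _ (hmem ht htL) (by linarith)]

theorem sub_sub_le_kobDist (hσ : IsNonexpandingCurve M L σ) (hk : IsPseudoDistOn (kobDist M) M)
    {s t : ℝ} (hs : s ∈ Icc 0 L) (ht : t ∈ Icc 0 L) :
    |s - t| - (L - kobDist M (σ 0) (σ L)) ≤ kobDist M (σ s) (σ t) := by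
  wlog hst : s ≤ t generalizing s t
  · rw [abs_sub_comm, kobDist_comm M (σ s)]
    exact this ht hs (le_of_not_ge hst)
  have h0 : (0 : ℝ) ∈ Icc 0 L := left_mem_Icc.2 (hs.1.trans hs.2)
  have hL : L ∈ Icc 0 L := right_mem_Icc.2 (hs.1.trans hs.2)
  rw [abs_sub_comm, abs_of_nonneg (sub_nonneg.2 hst)]
  linarith [hσ.kobDist_le 0 h0 s hs hs.1, hσ.kobDist_le t ht L hL ht.2,
    hk.triangle (hσ.mapsTo h0) (hσ.mapsTo hs) (hσ.mapsTo hL),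
    hk.triangle (hσ.mapsTo hs) (hσ.mapsTo ht) (hσ.mapsTo hL)]

theorem isAlmostGeodesic (hσ : IsNonexpandingCurve M L σ) (hM : IsEmbeddedComplexSubmanifold M)
    (hconn : IsPreconnected M) (hbdd : Bornology.IsBounded M) (hL : 0 ≤ L) {kap : ℝ}
    (hkap : L ≤ kobDist M (σ 0) (σ L) + kap) (hkap₀ : 0 ≤ kap) :
    IsAlmostGeodesic M 1 kap 0 L σ where
  mapsTo := hσ.mapsTo
  lower s hs t ht := by
    linarith [hσ.sub_sub_le_kobDist (isPseudoDistOn_kobDist hM hconn) ht hs]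
  upper s hs t ht := by
    linarith [hσ.kobDist_le_abs_sub ht hs]
  absolutelyContinuous := by
    refine (lipschitzOnWith_of_kobDist_le hM hconn hbdd ?_ ?_).absolutelyContinuousOnInterval <;>
      rw [uIcc_of_le hL]
    exacts [hσ.mapsTo, fun s hs t ht => hσ.kobDist_le_abs_sub hs ht]
  speed := by
    filter_upwards [hσ.speed] with t ht htmem
    obtain ⟨v, hv, hle⟩ := ht htmem
    exact ⟨hv.differentiableAt, by rwa [hv.deriv, ENNReal.ofReal_one]⟩

end IsNonexpandingCurve

theorem DiscChain.exists_isNonexpandingCurve (hk : IsPseudoDistOn (kobDist M) M) {l : ℝ}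
    (h : DiscChain M x y l) : ∃ σ, IsNonexpandingCurve M l σ ∧ σ 0 = x ∧ σ l = y := by
  induction h with
  | nil x hx =>
    refine ⟨fun _ => x, ⟨fun _ _ => hx, fun s _ t _ hst => ?_, .of_forall fun t ht => ?_⟩, rfl, rfl⟩
    · exact (kobDist_self hx).trans_le (sub_nonneg.2 hst)
    · exact absurd (ht.1.trans ht.2) (lt_irrefl _)
  | cons f hf a b ha hb z l h ih =>
    rw [mem_ball_zero_iff] at ha hb
    obtain ⟨σ, hσ, hσ0, hσl⟩ := ih
    obtain ⟨g, hg, hga, hgb⟩ := hf.exists_normalization ha hb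
    refine ⟨_, (hg.isNonexpandingCurve (poincareDist a b)).concat hk hσ (hgb.trans hσ0.symm),
      ?_, ?_⟩
    · simp only [if_pos (poincareDist_nonneg a b), Real.tanh_zero, Complex.ofReal_zero, hga]
    · rcases h.nonneg.eq_or_lt with rfl | hl
      · rw [add_zero, if_pos le_rfl, hgb, ← hσ0, hσl]
      · rw [if_neg (by linarith), add_sub_cancel_left, hσl]

theorem joinedByAlmostGeodesics (hM : IsEmbeddedComplexSubmanifold M) (hconn : IsPreconnected M)
    (hbdd : Bornology.IsBounded M) {kap : ℝ} (hkap : 0 < kap) :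
    JoinedByAlmostGeodesics M 1 kap := by
  intro x hx y hy _
  obtain ⟨l, hl, hchain⟩ := exists_discChain_lt hM hconn hx hy
    (lt_add_of_pos_right (kobDist M x y) hkap)
  obtain ⟨σ, hσ, rfl, rfl⟩ :=
    hchain.exists_isNonexpandingCurve (isPseudoDistOn_kobDist hM hconn)
  exact ⟨0, l, σ, hchain.nonneg,
    hσ.isAlmostGeodesic hM hconn hbdd hchain.nonneg hl.le hkap.le, rfl, rfl⟩

theorem IsAlmostGeodesic.isCoarseGeodesic {kap a b : ℝ} {σ : ℝ → EuclideanSpace ℂ (Fin d)}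
    (hσ : IsAlmostGeodesic M 1 kap a b σ) (hab : a ≤ b) :
    IsCoarseGeodesic (kobDist M) M kap a b σ where
  continuousOn := by simpa only [uIcc_of_le hab] using hσ.absolutelyContinuous.continuousOn
  mapsTo := hσ.mapsTo
  abs_sub_le s t has hst htb := by
    have hs : s ∈ Icc a b := ⟨has, hst.trans htb⟩
    have ht : t ∈ Icc a b := ⟨has.trans hst, htb⟩
    have hlower := hσ.lower t ht s hs
    have hupper := hσ.upper t ht s hs
    rw [abs_sub_comm, abs_of_nonneg (sub_nonneg.2 hst)] at hlower hupper
    exact abs_sub_le_iff.2 ⟨by linarith, by linarith⟩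

theorem IsRealGeodesic.isCoarseGeodesic (hM : IsEmbeddedComplexSubmanifold M)
    (hconn : IsPreconnected M) (hbdd : Bornology.IsBounded M) {a b : ℝ}
    {σ : ℝ → EuclideanSpace ℂ (Fin d)} (hσ : IsRealGeodesic M a b σ) :
    IsCoarseGeodesic (kobDist M) M 0 a b σ where
  continuousOn := (lipschitzOnWith_of_kobDist_le hM hconn hbdd hσ.mapsTo fun s hs t ht =>
    (hσ.isometry s hs t ht).ge).continuousOn
  mapsTo := hσ.mapsTo
  abs_sub_le s t has hst htb := by
    rw [← hσ.isometry s ⟨has, hst.trans htb⟩ t ⟨has.trans hst, htb⟩, abs_sub_comm s,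
      abs_of_nonneg (sub_nonneg.2 hst), sub_self, abs_zero]

end Curves

section Visibility

variable {M S : Set (EuclideanSpace ℂ (Fin d))} {o : EuclideanSpace ℂ (Fin d)}

theorem SphereSeparated.isTotallySeparated (hsep : SphereSeparated M S) (hSsub : S ⊆ bdry M) :
    IsTotallySeparated S := by
  intro p hp q hq hpq
  obtain ⟨p', -, r, -, hpr, hqr, hsphere⟩ := hsep p (hSsub hp) q (hSsub hq) hpq
  refine ⟨Metric.ball p' r, (Metric.closedBall p' r)ᶜ, Metric.isOpen_ball,
    Metric.isClosed_closedBall.isOpen_compl, hpr, hqr, fun x hx => ?_,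
    disjoint_compl_right.mono_left Metric.ball_subset_closedBall⟩
  rcases lt_trichotomy (dist x p') r with hlt | heq | hgt
  · exact Or.inl hlt
  · exact absurd (mem_inter hx heq) (hsphere ▸ notMem_empty x)
  · exact Or.inr (not_le.2 hgt)

theorem gromovProductBoundedAt_iff {p q : EuclideanSpace ℂ (Fin d)} :
    GromovProductBoundedAt M o p q ↔ IsBoundedUnder (· ≤ ·) (𝓝[M] p ×ˢ 𝓝[M] q)
      fun w => gromovProd (kobDist M) o w.1 w.2 :=
  limsup_coe_lt_top_iff_isBoundedUnder

theorem JoinedByAlmostGeodesics.exists_isCoarseGeodesic {kap : ℝ}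
    (h : JoinedByAlmostGeodesics M 1 kap) :
    ∀ x ∈ M, ∀ y ∈ M, x ≠ y → ∃ a b σ,
      a ≤ b ∧ IsCoarseGeodesic (kobDist M) M kap a b σ ∧ σ a = x ∧ σ b = y := by
  intro x hx y hy hxy
  obtain ⟨a, b, σ, hab, hσ, hends⟩ := h x hx y hy hxy
  exact ⟨a, b, σ, hab, hσ.isCoarseGeodesic hab, hends⟩

theorem IsVisibilitySubmanifold.gromovProductBoundedAt {kap : ℝ}
    (h : IsVisibilitySubmanifold M 1 kap) (hM : IsEmbeddedComplexSubmanifold M)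
    (hconn : IsPreconnected M) (ho : o ∈ M) {p q : EuclideanSpace ℂ (Fin d)}
    (hp : p ∈ bdry M) (hq : q ∈ bdry M) (hpq : p ≠ q) : GromovProductBoundedAt M o p q := by
  have hk := isPseudoDistOn_kobDist hM hconn
  obtain ⟨V, hV, W, hW, K, hKM, hK, hVW, hmeets⟩ := h.2 p hp q hq hpq
  obtain ⟨C, hC⟩ := bddAbove_image_inter_of_isBoundedUnder (T := M) hK fun z hz =>
    isBoundedUnder_of_locallyBounded hk (fun _ hx => hM.isBoundedUnder_kobDist hx) ho (hKM hz)
  refine gromovProductBoundedAt_iff.2 (isBoundedUnder_gromovProd_of_subarc hk ho hV hW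
    (κ := kap) (C := C) fun x ⟨hxV, hx⟩ y ⟨hyW, hy⟩ => ?_)
  have hxy : x ≠ y := (hVW.mono subset_closure subset_closure).ne_of_mem hxV hyW
  obtain ⟨a, b, σ, hab, hσ, rfl, rfl⟩ := h.1 x hx y hy hxy
  obtain ⟨t, ⟨hat, htb⟩, htK⟩ := hmeets a b σ hab hσ hxV hyW
  refine ⟨a, b, σ, hσ.isCoarseGeodesic hab, rfl, rfl, t, t, hat, le_rfl, htb, ?_⟩
  rw [hk.gromovProd_self (hKM htK)]
  exact hC ⟨σ t, ⟨htK, hKM htK⟩, rfl⟩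

theorem gromovProductBoundedAt_of_totallySeparated (hM : IsEmbeddedComplexSubmanifold M)
    (hconn : IsPreconnected M) (hbdd : Bornology.IsBounded M) (hS : IsClosed S)
    [TotallySeparatedSpace S] (ho : o ∈ M)
    (h : ∀ p ∈ bdry M \ S, ∀ q ∈ bdry M \ S, p ≠ q → GromovProductBoundedAt M o p q)
    {p q : EuclideanSpace ℂ (Fin d)} (hpq : p ≠ q) : GromovProductBoundedAt M o p q :=
  gromovProductBoundedAt_iff.2 <| isBoundedUnder_gromovProd_of_totallySeparated
    (isPseudoDistOn_kobDist hM hconn) (fun _ hx => hM.isBoundedUnder_kobDist hx) ho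
    hbdd.isCompact_closure hS
    (joinedByAlmostGeodesics hM hconn hbdd one_pos).exists_isCoarseGeodesic
    (fun p hp q hq hpq => gromovProductBoundedAt_iff.1 (h p hp q hq hpq)) hpq

theorem curvesVisible_of_isCoarseGeodesic (hM : IsEmbeddedComplexSubmanifold M)
    (hconn : IsPreconnected M) (hbdd : Bornology.IsBounded M) (hS : IsClosed S)
    [TotallySeparatedSpace S] (ho : o ∈ M)
    (hinf : ∀ p ∈ bdry M \ S, Tendsto (kobDist M · o) (𝓝[M] p) atTop)
    (h : ∀ p ∈ bdry M \ S, ∀ q ∈ bdry M \ S, p ≠ q → GromovProductBoundedAt M o p q)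
    {C : ℝ → ℝ → (ℝ → EuclideanSpace ℂ (Fin d)) → Prop} {κ : ℝ}
    (hC : ∀ a b σ, a ≤ b → C a b σ → IsCoarseGeodesic (kobDist M) M κ a b σ) :
    CurvesVisible M C := by
  intro p _ q _ hpq
  obtain ⟨V, hV, W, hW, K, hKM, hK, hVW, hmeets⟩ := exists_isCompact_forall_coarseGeodesic_meets
    (isPseudoDistOn_kobDist hM hconn) (fun _ hx => hM.isBoundedUnder_kobDist hx) ho
    hbdd.isCompact_closure hS hinf
    (fun p hp q hq hpq => gromovProductBoundedAt_iff.1 (h p hp q hq hpq)) κ hpq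
  exact ⟨V, hV, W, hW, K, hKM, hK, hVW, fun a b σ hab hσ => hmeets a b σ hab (hC a b σ hab hσ)⟩

end Visibility

end KobayashiVisibility
theorem mainTheorem8_general {d : ℕ} (M S : Set (EuclideanSpace ℂ (Fin d)))
    (hM : IsEmbeddedComplexSubmanifold M) (hconn : IsPreconnected M)
    (hbdd : Bornology.IsBounded M) (hS : IsClosed S) (hdisc : IsTotallyDisconnected S)
    (o₀ : EuclideanSpace ℂ (Fin d)) (ho₀ : o₀ ∈ M)
    (hinf : ∀ p ∈ bdry M \ S, Tendsto (fun z => kobDist M z o₀) (𝓝[M] p) atTop)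
    (o : EuclideanSpace ℂ (Fin d)) (ho : o ∈ M) :
    List.TFAE [
      ∀ p ∈ bdry M \ S, ∀ q ∈ bdry M \ S, p ≠ q → GromovProductBoundedAt M o p q,
      ∀ p ∈ bdry M, ∀ q ∈ bdry M, p ≠ q → GromovProductBoundedAt M o p q,
      (∀ kap : ℝ, 0 < kap → IsVisibilitySubmanifold M 1 kap) ∧ AlmostGeodesicsVisible M 1 0] ∧
    ((∀ kap : ℝ, 0 < kap → IsVisibilitySubmanifold M 1 kap) ∧ AlmostGeodesicsVisible M 1 0 →
      CurvesVisible M (IsRealGeodesic M)) := by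
  have : LocallyCompactSpace S := hS.isClosedEmbedding_subtypeVal.locallyCompactSpace
  have : TotallySeparatedSpace S :=
    loc_compact_t2_tot_disc_iff_tot_sep.1 (totallyDisconnectedSpace_subtype_iff.2 hdisc)
  have hinf_o : ∀ p ∈ bdry M \ S, Tendsto (kobDist M · o) (𝓝[M] p) atTop := fun p hp =>
    tendsto_atTop_of_basepoint (isPseudoDistOn_kobDist hM hconn) ho ho₀ inf_le_right (hinf p hp)
  have bounded_of_visible (h : IsVisibilitySubmanifold M 1 1) : ∀ p ∈ bdry M \ S,
      ∀ q ∈ bdry M \ S, p ≠ q → GromovProductBoundedAt M o p q :=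
    fun p hp q hq => h.gromovProductBoundedAt hM hconn ho hp.1 hq.1
  constructor
  · tfae_have 1 → 2 := fun h p _ q _ =>
      gromovProductBoundedAt_of_totallySeparated hM hconn hbdd hS ho h
    tfae_have 2 → 1 := fun h p hp q hq => h p hp.1 q hq.1
    tfae_have 1 → 3 := by
      intro h
      have hvis (kap : ℝ) : AlmostGeodesicsVisible M 1 kap :=
        curvesVisible_of_isCoarseGeodesic hM hconn hbdd hS ho hinf_o h
          fun _ _ _ hab hσ => hσ.isCoarseGeodesic hab
      exact ⟨fun kap hkap => ⟨joinedByAlmostGeodesics hM hconn hbdd hkap, hvis kap⟩, hvis 0⟩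
    tfae_have 3 → 1 := fun h => bounded_of_visible (h.1 1 one_pos)
    tfae_finish
  · exact fun h => curvesVisible_of_isCoarseGeodesic hM hconn hbdd hS ho hinf_o
      (bounded_of_visible (h.1 1 one_pos)) fun _ _ _ _ hσ => hσ.isCoarseGeodesic hM hconn hbdd

theorem mainTheorem8 {d : ℕ} (M S : Set (EuclideanSpace ℂ (Fin d)))
    (hM : IsEmbeddedComplexSubmanifold M) (hconn : IsConnected M) (hbdd : Bornology.IsBounded M)
    (hSsub : S ⊆ bdry M) (hS : IsClosed S) (hsep : SphereSeparated M S)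
    (o₀ : EuclideanSpace ℂ (Fin d)) (ho₀ : o₀ ∈ M)
    (hinf : ∀ p ∈ bdry M \ S, Filter.Tendsto (fun z => kobDist M z o₀) (nhdsWithin p M) Filter.atTop)
    (o : EuclideanSpace ℂ (Fin d)) (ho : o ∈ M) :
    List.TFAE [
      ∀ p ∈ bdry M \ S, ∀ q ∈ bdry M \ S, p ≠ q → GromovProductBoundedAt M o p q,
      ∀ p ∈ bdry M, ∀ q ∈ bdry M, p ≠ q → GromovProductBoundedAt M o p q,
      (∀ kap : ℝ, 0 < kap → IsVisibilitySubmanifold M 1 kap) ∧ AlmostGeodesicsVisible M 1 0] ∧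
    ((∀ kap : ℝ, 0 < kap → IsVisibilitySubmanifold M 1 kap) ∧ AlmostGeodesicsVisible M 1 0 →
      KobComplete M → IsBNTVisibilitySubmanifold M) := by
  have h := mainTheorem8_general M S hM hconn.isPreconnected hbdd hS
    (hsep.isTotallySeparated hSsub).isTotallyDisconnected o₀ ho₀ hinf o ho
  exact ⟨h.1, fun h₃ hcomplete => ⟨hcomplete, h.2 h₃⟩⟩
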